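/- Consider the linear bandit with a finite, nonempty arm set $\mathcal X\subset\mathbb R^d$, $d\ge 1$, and an unknown reward vector $\theta\in\mathbb R^d$. In each round $t$ a (possibly randomized) algorithm chooses an arm $x_t\in\mathcal X$ depending on the rewards observed so far (and on an internal random seed), and then observes $y_t=\langle x_t,\theta\rangle+\eta_t$, where $\eta_1,\eta_2,\dots$ are i.i.d. $\mathcal N(0,1)$ and independent of the seed; it also decides, from the same information, when to stop and which arm $\widehat x\in\mathcal X$ to output. It is called $(\varepsilon,\delta)$-PAC if for every $\theta\in\mathbb R^d$, with probability at least $1-\delta$, it stops and $\max_{x\in\mathcal X}\langle x-\widehat x,\theta\rangle\le\varepsilon$. Write $(a)_+:=\max\{1,a\}$. Then there is an absolute constant $C>0$ such that for every $d\ge1$, every finite nonempty $\mathcal X\subset\mathbb R^d$, every $\varepsilon\in(0,1]$ and every $\delta\in(0,1)$ there is an adaptive $(\varepsilon,\delta)$-PAC algorithm for $\mathcal X$ that, on every realization and for every $\theta$, uses at most $$C\,\frac{d\,\log\!\big((|\mathcal X|/d)_+/\delta\big)}{\varepsilon^2}$$ samples. -/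

import Mathlib

open MeasureTheory ProbabilityTheory

/-- A (possibly adaptive, possibly randomized) pure-exploration algorithm for the linear bandit with
arm set `𝒳 ⊆ ℝᵈ`. Every decision is a measurable function of the internal random seed and of the
rewards observed so far (the arms pulled so far are themselves functions of these).
* `sample t u h` is the arm pulled after the `t` rewards `h` have been observed;
* `Stops t u h` says that the algorithm stops once the `t` rewards `h` have been observed;
* `recommend t u h` is the arm that is output if the algorithm stops at that moment. -/
structure BanditAlgorithm {d : ℕ} (𝒳 : Set (EuclideanSpace ℝ (Fin d))) where
  Seed : Type
  [seedSpace : MeasurableSpace Seed]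
  seedLaw : Measure Seed
  [seedProb : IsProbabilityMeasure seedLaw]
  sample : (t : ℕ) → Seed → (Fin t → ℝ) → EuclideanSpace ℝ (Fin d)
  sample_mem : ∀ t u h, sample t u h ∈ 𝒳
  measurable_sample : ∀ t, Measurable fun p : Seed × (Fin t → ℝ) => sample t p.1 p.2
  Stops : (t : ℕ) → Seed → (Fin t → ℝ) → Prop
  measurableSet_stops : ∀ t, MeasurableSet {p : Seed × (Fin t → ℝ) | Stops t p.1 p.2}
  recommend : (t : ℕ) → Seed → (Fin t → ℝ) → EuclideanSpace ℝ (Fin d)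
  recommend_mem : ∀ t u h, recommend t u h ∈ 𝒳
  measurable_recommend : ∀ t, Measurable fun p : Seed × (Fin t → ℝ) => recommend t p.1 p.2

attribute [instance] BanditAlgorithm.seedSpace BanditAlgorithm.seedProb

namespace BanditAlgorithm

variable {d : ℕ} {𝒳 : Set (EuclideanSpace ℝ (Fin d))}

/-- The first `t` rewards when the reward vector is `θ`, the seed is `u` and the noise is `η`:
the reward of round `t` is `⟨x_t, θ⟩ + η_t`, where `x_t` is the arm chosen from the seed and the
earlier rewards. -/
noncomputable def history (A : BanditAlgorithm 𝒳) (θ : EuclideanSpace ℝ (Fin d)) (u : A.Seed)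
    (η : ℕ → ℝ) : (t : ℕ) → (Fin t → ℝ)
  | 0 => fun i => i.elim0
  | t + 1 => Fin.snoc (α := fun _ => ℝ) (A.history θ u η t)
      (inner ℝ (A.sample t u (A.history θ u η t)) θ + η t)

/-- The number of samples used: the first time at which the algorithm stops, and `⊤` if it never
does. -/
noncomputable def stoppingTime (A : BanditAlgorithm 𝒳) (θ : EuclideanSpace ℝ (Fin d))
    (u : A.Seed) (η : ℕ → ℝ) : ℕ∞ :=
  ⨅ (t : ℕ) (_ : A.Stops t u (A.history θ u η t)), (t : ℕ∞)

/-- The arm that is output upon stopping (only meaningful if the algorithm stops). -/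
noncomputable def output (A : BanditAlgorithm 𝒳) (θ : EuclideanSpace ℝ (Fin d))
    (u : A.Seed) (η : ℕ → ℝ) : EuclideanSpace ℝ (Fin d) :=
  A.recommend (A.stoppingTime θ u η).toNat u (A.history θ u η (A.stoppingTime θ u η).toNat)

/-- The joint law of the seed and of the noise sequence: they are independent, and the noise
variables are i.i.d. standard Gaussian. -/
noncomputable def seedNoiseLaw (A : BanditAlgorithm 𝒳) : Measure (A.Seed × (ℕ → ℝ)) :=
  A.seedLaw.prod (Measure.infinitePi fun _ : ℕ => gaussianReal 0 1)

/-- The algorithm is `(ε, δ)`-PAC: whatever the reward vector `θ` is, with probability at least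
`1 - δ` it stops and outputs an arm `x̂` with `max_{x ∈ 𝒳} ⟨x - x̂, θ⟩ ≤ ε`. -/
def IsPAC (A : BanditAlgorithm 𝒳) (ε δ : ℝ) : Prop :=
  ∀ θ : EuclideanSpace ℝ (Fin d),
    ENNReal.ofReal (1 - δ) ≤ A.seedNoiseLaw
      {ω | A.stoppingTime θ ω.1 ω.2 < ⊤ ∧
        ∀ x ∈ 𝒳, inner ℝ (x - A.output θ ω.1 ω.2) θ ≤ ε}

/-- The algorithm always stops after at most `N` samples, whatever the reward vector and the
realization of the seed and of the noise are. -/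
def UsesAtMost (A : BanditAlgorithm 𝒳) (N : ℕ) : Prop :=
  ∀ (θ : EuclideanSpace ℝ (Fin d)) (u : A.Seed) (η : ℕ → ℝ), A.stoppingTime θ u η ≤ N

end BanditAlgorithm

/-!
The algorithm is phased elimination: in each round the surviving arms are sampled along a fixed
design, their values are estimated linearly, and only the arms with the largest estimates are kept.

*Design.* A determinant-maximizing `n`-tuple of points of a set of arms spanning `r` dimensions
yields, for each arm of the set, an unbiased linear estimator of variance at most `2 r / n` as soon
as `n ≥ 2 r` (`exists_exact_design`). Working directly with `n`-tuples instead of probability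
weights makes rounding unnecessary: the bound follows from the fact that no exchange of a single
point increases the determinant.

*One round.* If each estimate errs by `ε / 2`, in either direction, with probability at most `p`,
then the `k` arms with the largest estimates among `K` arms contain an `ε`-optimal one except with
probability `p (1 + K / k)`, by Markov's inequality for the number of overestimated arms
(`measureReal_topSet_loses_le`). Only the ratio `K / k` enters here, not `K`. The first round cuts
the `K` given arms down to `D = min K d`, which costs `d log ((K / D) / δ) / ε ^ 2` samples up to
constants. The later rounds halve the number of arms; since the dimension is at most the number of
arms, their costs have a convergent sum even though the accuracies and the failure probabilities
are summable (`exists_isPAC_of_window`). As the survivors of a round are independent of the noise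
of the later rounds, failure probabilities add up (`gaussianNoise_survivors_loses_le`).

*Confidence `δ` close to `1`.* If `max 1 (K / d) / δ < 2`, the budget may be far below `d / ε ^ 2`,
and phased elimination on all arms is too expensive. But then only the success probability
`1 - δ < 1 / 2` is required, and it suffices to restrict to a random window of
`⌈2 (1 - δ) K⌉` arms, which contains the best arm with probability at least `2 (1 - δ)`,
and to succeed there with probability `1 / 2`. If the window is a single arm, no samples are needed.
-/

/-! ### Exact designs -/

open Matrix in
/-- Exchanging one design point `y` for another point `x` changes the determinant of the Gram
matrix `V` by an explicit factor: the rank-two case of the matrix determinant lemma. -/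
lemma det_gram_swap {r : ℕ} (V : Matrix (Fin r) (Fin r) ℝ) (hVs : Vᵀ = V) (hV : IsUnit V.det)
    (x y : Fin r → ℝ) :
    (V + (vecMulVec x x - vecMulVec y y)).det =
      V.det * ((1 + x ⬝ᵥ (V⁻¹ *ᵥ x)) * (1 - y ⬝ᵥ (V⁻¹ *ᵥ y)) + (y ⬝ᵥ (V⁻¹ *ᵥ x)) ^ 2) := by
  have hsym : x ⬝ᵥ (V⁻¹ *ᵥ y) = y ⬝ᵥ (V⁻¹ *ᵥ x) := by
    rw [dotProduct_mulVec, ← mulVec_transpose, transpose_nonsing_inv, hVs, dotProduct_comm]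
  have h1 : vecMulVec x x - vecMulVec y y =
      (Matrix.of fun i (k : Fin 2) => ![x i, y i] k) * (Matrix.of ![x, -y]) := by
    ext i j
    simp [Matrix.mul_apply, vecMulVec_apply, Fin.sum_univ_two, sub_eq_add_neg]
  have h2 : (Matrix.of ![x, -y]) * V⁻¹ * (Matrix.of fun i (k : Fin 2) => ![x i, y i] k) =
      !![x ⬝ᵥ (V⁻¹ *ᵥ x), x ⬝ᵥ (V⁻¹ *ᵥ y); -(y ⬝ᵥ (V⁻¹ *ᵥ x)), -(y ⬝ᵥ (V⁻¹ *ᵥ y))] := by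
    rw [Matrix.mul_assoc]
    ext i j
    fin_cases i <;> fin_cases j <;>
      simp [Matrix.mul_apply, dotProduct, mulVec, Finset.sum_neg_distrib]
  rw [h1, det_add_mul _ _ hV, h2, Matrix.det_fin_two, hsym]
  simp
  left
  ring

open Matrix in
/-- The exact design in coordinates. An `n`-tuple `s` maximizing the determinant of
`V = ∑ i, c (s i) (c (s i))ᵀ` works, with the least-squares coefficients
`a i = ⟨c (s i), V⁻¹ (c x)⟩`, whose squares sum to `⟨c x, V⁻¹ (c x)⟩`: by maximality no exchange
of a single design point increases the determinant, and summing these `n` inequalities gives the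
bound. The hypothesis `hc` says that the coordinate vectors are among the points, so that
the maximal determinant is positive. -/
lemma exists_exact_design_coords {ι : Type*} [Finite ι] {r n : ℕ} (hrn : r ≤ n)
    (c : ι → Fin r → ℝ) (i₀ : ι) (hc : ∀ j, ∃ i, c i = Pi.single j 1) :
    ∃ s : Fin n → ι, ∀ x, ∃ a : Fin n → ℝ, (∑ i, a i • c (s i)) = c x ∧
      ((n : ℝ) - r + 1) * ∑ i, a i ^ 2 ≤ r := by
  let M : (Fin n → ι) → Matrix (Fin n) (Fin r) ℝ := fun s => Matrix.of fun i => c (s i)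
  have : Nonempty (Fin n → ι) := ⟨fun _ => i₀⟩
  obtain ⟨s, hs⟩ := Finite.exists_max (α := Fin n → ι) (fun s => ((M s)ᵀ * M s).det)
  choose b hb using hc
  have hpos : 0 < ((M s)ᵀ * M s).det := by
    let s₀ : Fin n → ι := fun i => if h : i.1 < r then b ⟨i, h⟩ else i₀
    refine lt_of_lt_of_le ?_ (hs s₀)
    have := (Matrix.PosDef.conjTranspose_mul_self (M s₀) ?_).det_pos
    · simpa using this
    · rw [← Matrix.coe_mulVecLin, ← LinearMap.ker_eq_bot, LinearMap.ker_eq_bot']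
      intro v hv
      ext j
      have := congrFun hv ⟨j, j.2.trans_le hrn⟩
      simpa [M, s₀, Matrix.mulVec, hb] using this
  refine ⟨s, fun x => ?_⟩
  set V := (M s)ᵀ * M s with hVdef
  have hV : IsUnit V.det := hpos.ne'.isUnit
  have hVs : Vᵀ = V := by simp [hVdef]
  set a : Fin n → ℝ := M s *ᵥ (V⁻¹ *ᵥ c x) with ha
  have hai : ∀ i, a i = c (s i) ⬝ᵥ (V⁻¹ *ᵥ c x) := fun i => rfl
  have hsq : ∑ i, a i ^ 2 = c x ⬝ᵥ (V⁻¹ *ᵥ c x) := by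
    have : ∑ i, a i ^ 2 = a ⬝ᵥ a := by simp [dotProduct, sq]
    rw [this]
    nth_rw 1 [ha]
    rw [dotProduct_comm, dotProduct_mulVec, ← mulVec_transpose, ha, mulVec_mulVec, mulVec_mulVec,
      ← hVdef, Matrix.mul_nonsing_inv _ hV, one_mulVec]
  have hsum : ∑ i, a i • c (s i) = c x := by
    have : ∑ i, a i • c (s i) = (M s)ᵀ *ᵥ a := by
      ext j
      simp [Matrix.mulVec, dotProduct, M, mul_comm]
    rw [this, ha, mulVec_mulVec, mulVec_mulVec, ← hVdef, Matrix.mul_nonsing_inv _ hV, one_mulVec]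
  have htr : ∑ i, c (s i) ⬝ᵥ (V⁻¹ *ᵥ c (s i)) = r := by
    have : ∑ i, c (s i) ⬝ᵥ (V⁻¹ *ᵥ c (s i)) = (M s * (V⁻¹ * (M s)ᵀ)).trace := by
      simp only [Matrix.trace, Matrix.diag, Matrix.mul_apply, dotProduct, mulVec]
      rfl
    rw [this, Matrix.trace_mul_comm, Matrix.mul_assoc, ← hVdef, Matrix.nonsing_inv_mul _ hV]
    simp
  refine ⟨a, hsum, ?_⟩
  -- The exchange inequality: replacing `s i` by `x` does not increase the determinant.
  have key : ∀ i, (1 + c x ⬝ᵥ (V⁻¹ *ᵥ c x)) * (1 - c (s i) ⬝ᵥ (V⁻¹ *ᵥ c (s i))) + a i ^ 2 ≤ 1 := by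
    intro i
    have h := hs (Function.update s i x)
    have hup : (M (Function.update s i x))ᵀ * M (Function.update s i x) =
        V + (vecMulVec (c x) (c x) - vecMulVec (c (s i)) (c (s i))) := by
      have hg : ∀ t, (M t)ᵀ * M t = ∑ i, vecMulVec (c (t i)) (c (t i)) := by
        intro t
        ext j k
        simp [Matrix.mul_apply, Matrix.sum_apply, vecMulVec_apply, M]
      rw [hg, hVdef, hg, ← Finset.add_sum_erase _ _ (Finset.mem_univ i),
        ← Finset.add_sum_erase (a := i) _ (fun i => vecMulVec (c (s i)) (c (s i)))
          (Finset.mem_univ i)]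
      have : ∑ x_1 ∈ Finset.univ.erase i, vecMulVec (c (Function.update s i x x_1))
          (c (Function.update s i x x_1)) =
          ∑ x_1 ∈ Finset.univ.erase i, vecMulVec (c (s x_1)) (c (s x_1)) := by
        refine Finset.sum_congr rfl fun k hk => ?_
        rw [Function.update_of_ne (Finset.ne_of_mem_erase hk)]
      rw [this, Function.update_self]
      abel
    simp only [hup] at h
    rw [det_gram_swap V hVs hV, ← hai] at h
    exact le_of_mul_le_mul_left (by simpa using h) hpos
  have hall := Finset.sum_le_sum fun i (_ : i ∈ Finset.univ) => key i
  rw [Finset.sum_add_distrib, ← Finset.mul_sum, Finset.sum_sub_distrib, htr, hsq] at hall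
  simp at hall
  rw [hsq]
  linarith

/-- Every nonempty finite set `S` spanning at most `r` dimensions has an exact design of any size
`n ≥ 2 r`: points `s 0, …, s (n - 1)` of `S` of which every `x ∈ S` is a linear combination whose
squared coefficients sum to at most `2 r / n`. Thus `⟨x, θ⟩` has an unbiased linear estimator of
variance at most `2 r / n` from one noisy evaluation at each `s i`. -/
theorem exists_exact_design {E : Type*} [AddCommGroup E] [Module ℝ E] (S : Finset E)
    (hS : S.Nonempty) {r n : ℕ} (hr : Module.finrank ℝ (Submodule.span ℝ (S : Set E)) ≤ r)
    (hn : 2 * r ≤ n) (hn0 : 0 < n) :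
    ∃ s : Fin n → S, ∀ x ∈ S, ∃ a : Fin n → ℝ, (∑ i, a i • (s i : E)) = x ∧
      ∑ i, a i ^ 2 ≤ 2 * r / n := by
  obtain ⟨f, hfS, hfspan, hfli⟩ := Submodule.exists_fun_fin_finrank_span_eq ℝ (S : Set E)
  generalize Module.finrank ℝ (Submodule.span ℝ (S : Set E)) = r' at *
  have hmem : ∀ x : S, ∃ c : Fin r' → ℝ, ∑ j, c j • f j = x := by
    intro x
    have : (x : E) ∈ Submodule.span ℝ (Set.range f) := hfspan ▸ Submodule.subset_span x.2
    exact (Submodule.mem_span_range_iff_exists_fun ℝ).1 this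
  -- `c x` is the coordinate vector of `x` in the basis `f` of the span.
  choose c hc using hmem
  obtain ⟨x₀, hx₀⟩ := hS
  obtain ⟨s, hs⟩ := exists_exact_design_coords (n := n) (by omega) c ⟨x₀, hx₀⟩ (fun j => by
    refine ⟨⟨f j, hfS j⟩, ?_⟩
    have h := hc ⟨f j, hfS j⟩
    have h0 : ∑ k, (c ⟨f j, hfS j⟩ - (Pi.single j 1 : Fin r' → ℝ)) k • f k = 0 := by
      simp [sub_smul, h, Pi.single_apply]
    have h1 := Fintype.linearIndependent_iff.1 hfli _ h0
    ext k
    have := h1 k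
    simp only [Pi.sub_apply] at this
    linarith)
  refine ⟨s, fun x hx => ?_⟩
  obtain ⟨a, ha, hb⟩ := hs ⟨x, hx⟩
  refine ⟨a, ?_, ?_⟩
  · refine Eq.trans ?_ (hc ⟨x, hx⟩)
    rw [← ha]
    simp_rw [← hc, Finset.smul_sum, Finset.sum_apply, Pi.smul_apply, Finset.sum_smul, smul_smul,
      smul_eq_mul]
    rw [Finset.sum_comm]
  · have hn' : (0 : ℝ) < n := by exact_mod_cast hn0
    have h2 : (2 : ℝ) * r ≤ n := by exact_mod_cast hn
    have h3 : (r' : ℝ) ≤ r := by exact_mod_cast hr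
    rw [le_div_iff₀ hn']
    have h4 : 0 ≤ ∑ i, a i ^ 2 := Finset.sum_nonneg fun i _ => sq_nonneg _
    nlinarith

/-! ### Keeping the arms with the largest estimates -/

/-- `S'` consists of `k` elements of `S` with the largest values of `f`, with ties
broken arbitrarily. -/
def IsTopSubset {α : Type*} (k : ℕ) (S : Finset α) (f : α → ℝ) (S' : Finset α) : Prop :=
  S' ⊆ S ∧ S'.card = k ∧ ∀ x ∈ S', ∀ y ∈ S, y ∉ S' → f y ≤ f x

lemma exists_isTopSubset {α : Type*} {k : ℕ} {S : Finset α} (f : α → ℝ) (hk : k ≤ S.card) :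
    ∃ S', IsTopSubset k S f S' := by
  classical
  induction k with
  | zero => exact ⟨∅, by simp, by simp, by simp⟩
  | succ k ih =>
    obtain ⟨T, hTS, hTk, hT⟩ := ih (by omega)
    have hne : (S \ T).Nonempty := by
      rw [← Finset.card_pos, Finset.card_sdiff_of_subset hTS]; omega
    obtain ⟨m, hm, hmax⟩ := (S \ T).exists_max_image f hne
    rw [Finset.mem_sdiff] at hm
    refine ⟨insert m T, Finset.insert_subset hm.1 hTS, by simp [hm.2, hTk], ?_⟩
    intro x hx y hy hyT
    rw [Finset.mem_insert, not_or] at hyT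
    rcases Finset.mem_insert.1 hx with rfl | hx
    · exact hmax y (Finset.mem_sdiff.2 ⟨hy, hyT.2⟩)
    · exact hT x hx y hy hyT.2

open Classical in
/-- A choice of a member of a family of finsets, and `∅` if the family is empty. It depends on the
family alone, which is what makes `topSet` below measurable in `f`. -/
noncomputable def selectFinset {α : Type*} (T : Set (Finset α)) : Finset α :=
  if h : T.Nonempty then h.some else ∅

/-- The `k` elements of `S` with the largest values of `f`, or `∅` if `S` has fewer
than `k` elements. -/
noncomputable def topSet {α : Type*} (k : ℕ) (S : Finset α) (f : α → ℝ) : Finset α :=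
  selectFinset {S' | IsTopSubset k S f S'}

lemma isTopSubset_topSet {α : Type*} {k : ℕ} {S : Finset α} (f : α → ℝ) (hk : k ≤ S.card) :
    IsTopSubset k S f (topSet k S f) := by
  have h : {S' | IsTopSubset k S f S'}.Nonempty := exists_isTopSubset f hk
  rw [topSet, selectFinset, dif_pos h]
  exact h.some_mem

lemma topSet_congr {α : Type*} {k : ℕ} {S : Finset α} {f g : α → ℝ} (h : ∀ x ∈ S, f x = g x) :
    topSet k S f = topSet k S g := by
  have : {S' | IsTopSubset k S f S'} = {S' | IsTopSubset k S g S'} := by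
    ext S'
    refine and_congr_right fun hS => and_congr_right fun _ => ?_
    refine forall₂_congr fun x hx => forall₂_congr fun y hy => ?_
    rw [h x (hS hx), h y hy]
  exact congrArg selectFinset this

lemma measurableSet_topSet_eq {α Ω : Type*} [Finite α] [MeasurableSpace Ω] (k : ℕ) (S : Finset α)
    {f : Ω → α → ℝ} (hf : ∀ x, Measurable fun ω => f ω x) (S' : Finset α) :
    MeasurableSet {ω | topSet k S (f ω) = S'} := by
  classical
  -- `topSet` is a function of the family of top subsets, and there are finitely many families.
  have hA : ∀ T : Set (Finset α), MeasurableSet {ω | {R | IsTopSubset k S (f ω) R} = T} := by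
    intro T
    have : {ω | {R | IsTopSubset k S (f ω) R} = T} =
        ⋂ R, {ω | IsTopSubset k S (f ω) R ↔ R ∈ T} := by
      ext ω; simp [Set.ext_iff]
    rw [this]
    refine MeasurableSet.iInter fun R => ?_
    have hR : MeasurableSet {ω | IsTopSubset k S (f ω) R} := by
      have : {ω | IsTopSubset k S (f ω) R} = {_ω | R ⊆ S} ∩ ({_ω | R.card = k} ∩
          ⋂ x, ⋂ y, {ω | x ∈ R → y ∈ S → y ∉ R → f ω y ≤ f ω x}) := by
        ext ω
        simp only [IsTopSubset, Set.mem_inter_iff, Set.mem_ofPred_eq, Set.mem_iInter]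
        exact ⟨fun h => ⟨h.1, h.2.1, fun x y hx hy hn => h.2.2 x hx y hy hn⟩,
          fun h => ⟨h.1, h.2.1, fun x hx y hy hn => h.2.2 x y hx hy hn⟩⟩
      rw [this]
      refine .inter (.const _) (.inter (.const _) (.iInter fun x => .iInter fun y => ?_))
      by_cases h : x ∈ R ∧ y ∈ S ∧ y ∉ R
      · have := measurableSet_le (hf y) (hf x)
        simpa [h.1, h.2.1, h.2.2] using this
      · have : {ω | x ∈ R → y ∈ S → y ∉ R → f ω y ≤ f ω x} = Set.univ := by
          ext ω; simp; tauto
        rw [this]; exact .univ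
    by_cases h : R ∈ T
    · simpa [h] using hR
    · have : {ω | IsTopSubset k S (f ω) R ↔ R ∈ T} = {ω | IsTopSubset k S (f ω) R}ᶜ := by
        ext ω; simp [h]
      rw [this]; exact hR.compl
  have : {ω | topSet k S (f ω) = S'} =
      ⋃ T : Set (Finset α), {ω | {R | IsTopSubset k S (f ω) R} = T} ∩
        {_ω | selectFinset T = S'} := by
    ext ω
    simp [topSet]
  rw [this]
  exact .iUnion fun T => (hA T).inter (.const _)

/-- Markov's inequality for the number of events among `E x`, `x ∈ S`, that occur. -/
lemma measureReal_exists_subset_forall_mem_le {α Ω : Type*} [MeasurableSpace Ω] (P : Measure Ω)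
    [IsProbabilityMeasure P] (S : Finset α) (E : α → Set Ω) (hE : ∀ x ∈ S, MeasurableSet (E x))
    {p : ℝ} (hp : ∀ x ∈ S, P.real (E x) ≤ p) {k : ℕ} (hk : 0 < k) :
    P.real {ω | ∃ T ⊆ S, T.card = k ∧ ∀ x ∈ T, ω ∈ E x} ≤ S.card * p / k := by
  have hk' : (0 : ℝ) < k := by exact_mod_cast hk
  let F : Ω → ℝ := fun ω => ∑ x ∈ S, (E x).indicator 1 ω
  have hF0 : 0 ≤ F := fun ω => Finset.sum_nonneg fun x _ => Set.indicator_nonneg (by simp) _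
  have hint : ∀ x ∈ S, Integrable ((E x).indicator (1 : Ω → ℝ)) P := fun x hx =>
    (integrable_const 1).indicator (hE x hx)
  have hFi : Integrable F P := integrable_finsetSum _ hint
  have hm := mul_meas_ge_le_integral_of_nonneg (ae_of_all P hF0) hFi (k : ℝ)
  have hFs : ∫ ω, F ω ∂P ≤ S.card * p := by
    rw [integral_finsetSum _ hint]
    calc _ ≤ ∑ x ∈ S, p := Finset.sum_le_sum fun x hx => by
            rw [integral_indicator_one (hE x hx)]; exact hp x hx
      _ = _ := by simp
  have hsub : {ω | ∃ T ⊆ S, T.card = k ∧ ∀ x ∈ T, ω ∈ E x} ⊆ {ω | (k : ℝ) ≤ F ω} := by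
    rintro ω ⟨T, hTS, hTk, hT⟩
    calc (k : ℝ) = ∑ x ∈ T, (E x).indicator 1 ω := by
          rw [Finset.sum_congr rfl fun x hx => Set.indicator_of_mem (hT x hx) _]; simp [hTk]
      _ ≤ F ω := Finset.sum_le_sum_of_subset_of_nonneg hTS fun x _ _ =>
          Set.indicator_nonneg (by simp) _
  rw [le_div_iff₀ hk', mul_comm]
  exact (mul_le_mul_of_nonneg_left (measureReal_mono hsub) hk'.le).trans (hm.trans hFs)

/-- One round of elimination: the `k` arms of `S` with the largest estimates `μ x + w x` contain an
`ε`-optimal arm of `S`, except with probability `p (1 + |S| / k)`. On failure either the best arm is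
underestimated by `ε / 2`, or `k` arms are overestimated by `ε / 2`. -/
lemma measureReal_topSet_loses_le {α Ω : Type*} [MeasurableSpace Ω] (P : Measure Ω)
    [IsProbabilityMeasure P] {k : ℕ} {S : Finset α} (hk : 0 < k) (hkS : k ≤ S.card) (μ : α → ℝ)
    {w : α → Ω → ℝ} (hw : ∀ x ∈ S, Measurable (w x)) {ε p : ℝ} (hε : 0 ≤ ε)
    (hup : ∀ x ∈ S, P.real {ω | ε / 2 ≤ w x ω} ≤ p)
    (hlow : ∀ x ∈ S, P.real {ω | ε / 2 ≤ - w x ω} ≤ p) :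
    P.real {ω | ¬ ∃ y ∈ topSet k S (fun x => μ x + w x ω), ∀ x ∈ S, μ x ≤ μ y + ε} ≤
      p * (1 + S.card / k) := by
  have hne : S.Nonempty := Finset.card_pos.1 (by omega)
  obtain ⟨b, hb, hmax⟩ := S.exists_max_image μ hne
  have hsub : {ω | ¬ ∃ y ∈ topSet k S (fun x => μ x + w x ω), ∀ x ∈ S, μ x ≤ μ y + ε} ⊆
      {ω | ε / 2 ≤ - w b ω} ∪ {ω | ∃ T ⊆ S, T.card = k ∧ ∀ x ∈ T, ω ∈ {ω | ε / 2 ≤ w x ω}} := by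
    intro ω hω
    by_cases h : ε / 2 ≤ - w b ω
    · exact Or.inl h
    right
    obtain ⟨hTS, hTk, hT⟩ := isTopSubset_topSet (fun x => μ x + w x ω) hkS
    refine ⟨_, hTS, hTk, fun x hx => ?_⟩
    have hbad : ∀ y ∈ topSet k S (fun x => μ x + w x ω), μ y + ε < μ b := by
      intro y hy
      by_contra hc
      exact hω ⟨y, hy, fun x hx => (hmax x hx).trans (not_lt.1 hc)⟩
    have hbx := hbad x hx
    by_cases hbT : b ∈ topSet k S (fun x => μ x + w x ω)
    -- If the best arm is kept, `hbad` is contradictory.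
    · have := hbad b hbT
      simp only [Set.mem_ofPred_eq] at h ⊢
      linarith
    · have := hT x hx b hb hbT
      simp only [Set.mem_ofPred_eq] at h ⊢
      linarith
  refine (measureReal_mono hsub).trans ((measureReal_union_le _ _).trans ?_)
  have h1 := hlow b hb
  have h2 := measureReal_exists_subset_forall_mem_le P S (fun x => {ω | ε / 2 ≤ w x ω})
    (fun x hx => measurableSet_le measurable_const (hw x hx)) hup hk
  calc _ ≤ p + S.card * p / k := add_le_add h1 h2
    _ = _ := by ring

/-! ### Gaussian noise -/

/-- The law of an i.i.d. sequence of standard Gaussian variables. -/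
noncomputable abbrev gaussianNoise : Measure (ℕ → ℝ) :=
  Measure.infinitePi fun _ : ℕ => gaussianReal 0 1

lemma iIndepFun_eval_gaussianNoise : iIndepFun (fun (i : ℕ) (η : ℕ → ℝ) => η i) gaussianNoise :=
  iIndepFun_infinitePi (X := fun _ (x : ℝ) => x) (fun _ => measurable_id)

lemma hasSubgaussianMGF_eval_gaussianNoise (i : ℕ) :
    HasSubgaussianMGF (fun η : ℕ → ℝ => η i) 1 gaussianNoise := by
  have hmap : gaussianNoise.map (fun η : ℕ → ℝ => η i) = gaussianReal 0 1 :=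
    Measure.infinitePi_map_eval _ i
  constructor
  · intro t
    have h := integrable_exp_mul_gaussianReal (μ := 0) (v := 1) t
    rw [← hmap] at h
    exact (integrable_map_measure (f := fun η : ℕ → ℝ => η i)
      (g := fun x => Real.exp (t * x)) (by fun_prop)
      (measurable_pi_apply i).aemeasurable).1 h
  · intro t
    rw [mgf_gaussianReal hmap]
    simp

lemma gaussianNoise_sum_tail (b : ℕ → ℝ) (F : Finset ℕ) {v t : ℝ} (hv : 0 < v)
    (hb : ∑ i ∈ F, b i ^ 2 ≤ v) (ht : 0 ≤ t) :
    gaussianNoise.real {η | t ≤ ∑ i ∈ F, b i * η i} ≤ Real.exp (-t ^ 2 / (2 * v)) := by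
  have hind : iIndepFun (fun (i : ℕ) (η : ℕ → ℝ) => b i * η i) gaussianNoise :=
    iIndepFun_eval_gaussianNoise.comp (fun i x => b i * x) (fun i => by fun_prop)
  have h := HasSubgaussianMGF.sum_of_iIndepFun (s := F) hind
    (fun i _ => (hasSubgaussianMGF_eval_gaussianNoise i).const_mul (b i))
  -- Passing to `v > 0` first avoids the division by zero that arises if all `b i` vanish.
  have h' : HasSubgaussianMGF (fun η : ℕ → ℝ => ∑ i ∈ F, b i * η i) v.toNNReal gaussianNoise := by
    refine ⟨h.integrable_exp_mul, fun t => (h.mgf_le t).trans (Real.exp_le_exp.2 ?_)⟩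
    rw [Real.coe_toNNReal _ hv.le]
    gcongr
    calc _ = ∑ i ∈ F, b i ^ 2 := by
          rw [NNReal.coe_sum]
          exact Finset.sum_congr rfl fun i _ => mul_one _
      _ ≤ v := hb
  simpa [Real.coe_toNNReal _ hv.le] using h'.measure_ge_le ht

/-- The sequence `η` with the coordinates outside `F` replaced by `0`. -/
def truncate (F : Finset ℕ) (η : ℕ → ℝ) : ℕ → ℝ := fun i => if i ∈ F then η i else 0

/-- Events that depend only on disjoint finite sets of coordinates of the noise are independent;
that `A` depends only on the coordinates in `F` is expressed by invariance under `truncate F`. -/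
lemma gaussianNoise_inter_of_truncate {F G : Finset ℕ} (hFG : Disjoint F G) {A B : Set (ℕ → ℝ)}
    (hA : MeasurableSet A) (hB : MeasurableSet B) (hAF : ∀ η, truncate F η ∈ A ↔ η ∈ A)
    (hBG : ∀ η, truncate G η ∈ B ↔ η ∈ B) :
    gaussianNoise.real (A ∩ B) = gaussianNoise.real A * gaussianNoise.real B := by
  have hind := iIndepFun_eval_gaussianNoise.indepFun_finset F G hFG (fun i => by fun_prop)
  let e : (H : Finset ℕ) → (H → ℝ) → ℕ → ℝ := fun H y i => if h : i ∈ H then y ⟨i, h⟩ else 0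
  have he : ∀ H, Measurable (e H) := fun H => measurable_pi_lambda _ fun i => by
    by_cases h : i ∈ H
    · simpa [e, h] using measurable_pi_apply _
    · simp [e, h]
  have het : ∀ H (η : ℕ → ℝ), e H (fun i : H => η i) = truncate H η := by
    intro H η; ext i; simp [e, truncate]
  have h := hind.measure_inter_preimage_eq_mul (e F ⁻¹' A) (e G ⁻¹' B) (he F hA) (he G hB)
  have hAe : (fun (η : ℕ → ℝ) (i : F) => η i) ⁻¹' (e F ⁻¹' A) = A := by
    ext η; simp only [Set.mem_preimage, het, hAF]
  have hBe : (fun (η : ℕ → ℝ) (i : G) => η i) ⁻¹' (e G ⁻¹' B) = B := by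
    ext η; simp only [Set.mem_preimage, het, hBG]
  rw [hAe, hBe] at h
  simp [measureReal_def, h]

/-! ### Elimination in rounds -/

/-- The arms surviving the first `l` rounds of an elimination that starts with `S₀`: round `l`
starts with a set `S` and keeps the `size (l + 1)` arms of `S` with the largest estimates
`est l S`. -/
noncomputable def survivors {α : Type*} (size : ℕ → ℕ) (S₀ : Finset α)
    (est : ℕ → Finset α → α → ℝ) : ℕ → Finset α
  | 0 => S₀
  | l + 1 => topSet (size (l + 1)) (survivors size S₀ est l) (est l (survivors size S₀ est l))

lemma survivors_congr {α : Type*} {size : ℕ → ℕ} {S₀ : Finset α} {e e' : ℕ → Finset α → α → ℝ}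
    {l : ℕ} (h : ∀ j < l, ∀ x ∈ survivors size S₀ e j,
      e j (survivors size S₀ e j) x = e' j (survivors size S₀ e j) x) :
    survivors size S₀ e l = survivors size S₀ e' l := by
  induction l with
  | zero => rfl
  | succ l ih =>
    have h1 := ih fun j hj => h j (by omega)
    have h2 := topSet_congr (k := size (l + 1)) (h l (by omega))
    simp only [survivors]
    rw [h2, h1]

lemma card_survivors {α : Type*} {size : ℕ → ℕ} {S₀ : Finset α} (e : ℕ → Finset α → α → ℝ) {p : ℕ}
    (h0 : S₀.card = size 0) (hsize : ∀ l < p, size (l + 1) ≤ size l) {l : ℕ} (hl : l ≤ p) :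
    (survivors size S₀ e l).card = size l := by
  induction l with
  | zero => exact h0
  | succ l ih =>
    have h1 := ih (by omega)
    exact (isTopSubset_topSet _ (by rw [h1]; exact hsize l (by omega))).2.1

lemma measurableSet_survivors_eq {α Ω : Type*} [Finite α] [MeasurableSpace Ω] (size : ℕ → ℕ)
    (S₀ : Finset α) {e : Ω → ℕ → Finset α → α → ℝ}
    (he : ∀ l S x, Measurable fun ω => e ω l S x) (l : ℕ) (S' : Finset α) :
    MeasurableSet {ω | survivors size S₀ (e ω) l = S'} := by
  induction l generalizing S' with
  | zero => exact .const (S₀ = S')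
  | succ l ih =>
    have : {ω | survivors size S₀ (e ω) (l + 1) = S'} = ⋃ S, {ω | survivors size S₀ (e ω) l = S} ∩
        {ω | topSet (size (l + 1)) S (e ω l S) = S'} := by
      ext ω
      simp [survivors]
    rw [this]
    exact .iUnion fun S => (ih S).inter (measurableSet_topSet_eq _ _ (fun x => he l S x) _)

/-- The number of samples taken before round `l`, when round `j` takes `len j` samples. -/
def startTime (len : ℕ → ℕ) (l : ℕ) : ℕ := ∑ j ∈ Finset.range l, len j

lemma startTime_succ (len : ℕ → ℕ) (l : ℕ) : startTime len (l + 1) = startTime len l + len l :=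
  Finset.sum_range_succ _ _

lemma startTime_mono (len : ℕ → ℕ) : Monotone (startTime len) :=
  monotone_nat_of_le_succ fun l => by rw [startTime_succ]; omega

lemma le_startTime {len : ℕ → ℕ} (hlen : ∀ l, 0 < len l) (l : ℕ) : l ≤ startTime len l := by
  induction l with
  | zero => simp
  | succ l ih => rw [startTime_succ]; have := hlen l; omega

/-- The round in which the sample number `t` (counted from `0`) is taken. The search bound `t` is
large enough when every round is nonempty. -/
def roundAt (len : ℕ → ℕ) (t : ℕ) : ℕ :=
  Nat.findGreatest (fun l => startTime len l ≤ t) t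

lemma roundAt_startTime_add {len : ℕ → ℕ} (hlen : ∀ l, 0 < len l) {l i : ℕ} (hi : i < len l) :
    roundAt len (startTime len l + i) = l := by
  rw [roundAt, Nat.findGreatest_eq_iff]
  have := le_startTime hlen l
  refine ⟨by omega, fun _ => by omega, fun n hn _ => ?_⟩
  have h1 := startTime_mono len hn
  rw [Nat.succ_eq_add_one, startTime_succ] at h1
  omega

/-- The linear estimate of arm `x` in round `l`, started with the set `S`, from the data `y`: the
combination of the data of that round with coefficients `coef l S x`. -/
def linEst {α : Type*} (len : ℕ → ℕ) (coef : ℕ → Finset α → α → ℕ → ℝ) (y : ℕ → ℝ)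
    (l : ℕ) (S : Finset α) (x : α) : ℝ :=
  ∑ i ∈ Finset.range (len l), coef l S x i * y (startTime len l + i)

lemma measurable_linEst {α : Type*} (len : ℕ → ℕ) (coef : ℕ → Finset α → α → ℕ → ℝ)
    (l : ℕ) (S : Finset α) (x : α) : Measurable fun y => linEst len coef y l S x := by
  unfold linEst
  fun_prop

lemma linEst_congr {α : Type*} {len : ℕ → ℕ} (coef : ℕ → Finset α → α → ℕ → ℝ) {y y' : ℕ → ℝ}
    {l : ℕ} (h : ∀ i, startTime len l ≤ i → i < startTime len (l + 1) → y i = y' i)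
    (S : Finset α) (x : α) : linEst len coef y l S x = linEst len coef y' l S x := by
  refine Finset.sum_congr rfl fun i hi => ?_
  rw [Finset.mem_range] at hi
  rw [h _ (by omega) (by rw [startTime_succ]; omega)]

/-- Union bound over the rounds of an elimination whose estimates are `μ x` plus a linear
combination of the noise of the current round. The set with which a round starts depends only on
the noise of the earlier rounds, hence is independent of the noise of the current one, so each
round `l` fails with probability at most `q l`, as if its set were fixed. -/
lemma gaussianNoise_survivors_loses_le {α : Type*} [Finite α] (size len : ℕ → ℕ) (p : ℕ)
    (S₀ : Finset α) (h0 : S₀.card = size 0) (hsize : ∀ l < p, size (l + 1) ≤ size l)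
    (hpos : ∀ l ≤ p, 0 < size l)
    (coef : ℕ → Finset α → α → ℕ → ℝ) (μ : α → ℝ) (ε q v : ℕ → ℝ)
    (hε : ∀ l < p, 0 ≤ ε l) (hv : ∀ l < p, 0 < v l)
    (hcoef : ∀ l < p, ∀ S : Finset α, S.card = size l → ∀ x ∈ S,
      ∑ i ∈ Finset.range (len l), coef l S x i ^ 2 ≤ v l)
    (hq : ∀ l < p, Real.exp (-(ε l / 2) ^ 2 / (2 * v l)) * (1 + size l / size (l + 1)) ≤ q l) :
    gaussianNoise.real {η |
      ¬ ∃ y ∈ survivors size S₀ (fun l S x => μ x + linEst len coef η l S x) p,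
        ∀ x ∈ S₀, μ x ≤ μ y + ∑ l ∈ Finset.range p, ε l} ≤ ∑ l ∈ Finset.range p, q l := by
  induction p with
  | zero =>
    have hne : S₀.Nonempty := Finset.card_pos.1 (h0 ▸ hpos 0 le_rfl)
    obtain ⟨b, hb, hmax⟩ := S₀.exists_max_image μ hne
    have : {η : ℕ → ℝ | ¬ ∃ y ∈ survivors size S₀ (fun l S x => μ x + linEst len coef η l S x) 0,
      ∀ x ∈ S₀, μ x ≤ μ y + ∑ l ∈ Finset.range 0, ε l} = ∅ := by
      ext η
      simpa [survivors] using ⟨b, hb, hmax⟩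
    rw [this]
    simp
  | succ p ih =>
    classical
    have := Fintype.ofFinite α
    specialize ih (fun l hl => hsize l (by omega)) (fun l hl => hpos l (by omega))
      (fun l hl => hε l (by omega)) (fun l hl => hv l (by omega))
      (fun l hl => hcoef l (by omega)) (fun l hl => hq l (by omega))
    set st : (ℕ → ℝ) → ℕ → Finset α :=
      fun η => survivors size S₀ (fun l S x => μ x + linEst len coef η l S x) with hst
    have hmeasA : ∀ S, MeasurableSet {η | st η p = S} := fun S =>
      measurableSet_survivors_eq size S₀
        (fun l S x => (measurable_linEst len coef l S x).const_add _) p S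
    -- `B S` is the event that round `p` would fail if it started with `S`.
    let B : Finset α → Set (ℕ → ℝ) := fun S =>
      {η | ¬ ∃ y ∈ topSet (size (p + 1)) S (fun x => μ x + linEst len coef η p S x),
        ∀ x ∈ S, μ x ≤ μ y + ε p}
    have hmeasB : ∀ S, MeasurableSet (B S) := by
      intro S
      have : B S = ⋃ T : Finset α,
          {η | topSet (size (p + 1)) S (fun x => μ x + linEst len coef η p S x) = T} ∩
            {_η | ¬ ∃ y ∈ T, ∀ x ∈ S, μ x ≤ μ y + ε p} := by
        ext η
        simp [B]
      rw [this]
      exact .iUnion fun T => (measurableSet_topSet_eq _ _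
        (fun x => (measurable_linEst len coef p S x).const_add _) _).inter (.const _)
    have hcardst : ∀ η, (st η p).card = size p := fun η =>
      card_survivors _ h0 hsize (Nat.le_succ p)
    have hB : ∀ S : Finset α, S.card = size p → gaussianNoise.real (B S) ≤ q p := by
      intro S hS
      have hvar := hcoef p (Nat.lt_succ_self p) S hS
      have hvp := hv p (Nat.lt_succ_self p)
      have hεp := hε p (Nat.lt_succ_self p)
      have htail : ∀ (b : ℕ → ℝ), ∑ i ∈ Finset.range (len p), b i ^ 2 ≤ v p →
          gaussianNoise.real {η | ε p / 2 ≤ ∑ i ∈ Finset.range (len p),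
            b i * η (startTime len p + i)} ≤ Real.exp (-(ε p / 2) ^ 2 / (2 * v p)) := by
        intro b hb
        have h := gaussianNoise_sum_tail (fun i => b (i - startTime len p))
          ((Finset.range (len p)).map (addLeftEmbedding (startTime len p))) hvp
          (by simpa using hb) (by linarith : 0 ≤ ε p / 2)
        simpa using h
      have h := measureReal_topSet_loses_le gaussianNoise (hpos (p + 1) le_rfl)
        (hS ▸ hsize p (Nat.lt_succ_self p)) μ
        (w := fun x η => linEst len coef η p S x)
        (fun x _ => measurable_linEst len coef p S x) hεp
        (p := Real.exp (-(ε p / 2) ^ 2 / (2 * v p)))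
        (fun x hx => htail _ (hvar x hx))
        (fun x hx => by
          have := htail (fun i => - coef p S x i) (by simpa using hvar x hx)
          simpa [linEst, Finset.sum_neg_distrib] using this)
      rw [hS] at h
      exact h.trans (hq p (Nat.lt_succ_self p))
    have hAB : ∀ S, gaussianNoise.real ({η | st η p = S} ∩ B S) =
        gaussianNoise.real {η | st η p = S} * gaussianNoise.real (B S) := by
      intro S
      refine gaussianNoise_inter_of_truncate (F := Finset.range (startTime len p))
        (G := Finset.Ico (startTime len p) (startTime len (p + 1))) ?_ (hmeasA S) (hmeasB S) ?_ ?_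
      · rw [Finset.disjoint_left]
        intro i hi hi'
        rw [Finset.mem_range] at hi
        rw [Finset.mem_Ico] at hi'
        omega
      · intro η
        have : st (truncate (Finset.range (startTime len p)) η) p = st η p := by
          refine survivors_congr fun j hj x _ => ?_
          rw [linEst_congr]
          intro i _ hi2
          have := startTime_mono len (show j + 1 ≤ p from hj)
          simp only [truncate, Finset.mem_range]
          rw [if_pos (by omega)]
        simp only [Set.mem_ofPred_eq, this]
      · intro η
        have : (fun x => μ x + linEst len coef
            (truncate (Finset.Ico (startTime len p) (startTime len (p + 1))) η) p S x) =
            fun x => μ x + linEst len coef η p S x := by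
          ext x
          rw [linEst_congr]
          intro i hi1 hi2
          simp [truncate, hi1, hi2]
        simp only [B, Set.mem_ofPred_eq, this]
    have hsub : {η | ¬ ∃ y ∈ st η (p + 1), ∀ x ∈ S₀, μ x ≤ μ y + ∑ l ∈ Finset.range (p + 1), ε l} ⊆
        {η | ¬ ∃ y ∈ st η p, ∀ x ∈ S₀, μ x ≤ μ y + ∑ l ∈ Finset.range p, ε l} ∪
          ⋃ S ∈ (Finset.univ : Finset (Finset α)), {η | st η p = S} ∩ B S := by
      intro η hη
      by_contra hc
      obtain ⟨y, hy, hyb⟩ : ∃ y ∈ st η p, ∀ x ∈ S₀, μ x ≤ μ y + ∑ l ∈ Finset.range p, ε l := by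
        by_contra h
        exact hc (Or.inl h)
      obtain ⟨z, hz, hzb⟩ : ∃ z ∈ st η (p + 1), ∀ x ∈ st η p, μ x ≤ μ z + ε p := by
        by_contra h
        exact hc (Or.inr (Set.mem_biUnion (Finset.mem_univ (st η p)) ⟨rfl, h⟩))
      refine hη ⟨z, hz, fun x hx => ?_⟩
      rw [Finset.sum_range_succ]
      have h1 := hyb x hx
      have h2 := hzb y hy
      linarith
    have hone : ∑ S : Finset α, gaussianNoise.real {η | st η p = S} = 1 := by
      rw [← measureReal_biUnion_finset (fun S _ T _ hST => Set.disjoint_left.2 fun η h1 h2 =>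
        hST (h1.symm.trans h2)) (fun S _ => hmeasA S)]
      have : (⋃ S ∈ (Finset.univ : Finset (Finset α)), {η | st η p = S}) = Set.univ := by
        ext η; simp
      rw [this]; simp
    have hsum : ∑ S : Finset α, gaussianNoise.real ({η | st η p = S} ∩ B S) ≤ q p := by
      calc _ ≤ ∑ S : Finset α, gaussianNoise.real {η | st η p = S} * q p := by
            refine Finset.sum_le_sum fun S _ => ?_
            rw [hAB]
            by_cases hS : S.card = size p
            · exact mul_le_mul_of_nonneg_left (hB S hS) measureReal_nonneg
            · have : {η | st η p = S} = ∅ := by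
                ext η
                simp only [Set.mem_ofPred_eq, Set.mem_empty_iff_false, iff_false]
                rintro rfl
                exact hS (hcardst η)
              simp [this]
        _ = q p := by rw [← Finset.sum_mul, hone, one_mul]
    rw [Finset.sum_range_succ q]
    refine (measureReal_mono hsub).trans ((measureReal_union_le _ _).trans (add_le_add ih ?_))
    exact (measureReal_biUnion_finset_le _ _).trans hsum

/-! ### Phased elimination as a bandit algorithm -/

lemma measurable_comp_of_measurableSet_fiber {Ω β γ : Type*} [MeasurableSpace Ω]
    [MeasurableSpace γ] [Countable β] {A : Ω → β} (hA : ∀ b, MeasurableSet {ω | A ω = b})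
    (g : β → γ) : Measurable fun ω => g (A ω) := by
  let _ : MeasurableSpace β := ⊤
  have h : Measurable A := measurable_to_countable' hA
  exact (measurable_from_top (f := g)).comp h

/-- A finite list of rewards, continued by zeros. -/
def extendZero {t : ℕ} (h : Fin t → ℝ) : ℕ → ℝ := fun i => if hi : i < t then h ⟨i, hi⟩ else 0

lemma measurable_extendZero (t : ℕ) : Measurable (extendZero : (Fin t → ℝ) → ℕ → ℝ) :=
  measurable_pi_lambda _ fun i => by
    by_cases h : i < t
    · simpa [extendZero, h] using measurable_pi_apply _
    · simp [extendZero, h]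

open Classical in
/-- An element of `S`, and `x₀` if `S` is empty. -/
noncomputable def pickArm {α : Type*} (x₀ : α) (S : Finset α) : α :=
  if h : S.Nonempty then h.choose else x₀

lemma pickArm_mem {α : Type*} (x₀ : α) {S : Finset α} (h : S.Nonempty) : pickArm x₀ S ∈ S := by
  rw [pickArm, dif_pos h]; exact h.choose_spec

/-- The phased elimination algorithm. The seed `u`, uniform on `Fin W`, selects the initial set
`init u`. Round `l` pulls the arms `pull l S 0, pull l S 1, …`, where `S` is the set of survivors,
and keeps the `size (l + 1)` arms with the largest linear estimates. After `p` rounds the algorithm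
stops and returns a survivor; `x₀` is only a default value. -/
noncomputable abbrev eliminationAlgorithm {d : ℕ} {𝒳 : Finset (EuclideanSpace ℝ (Fin d))} (x₀ : 𝒳)
    {W : ℕ} [NeZero W] (init : Fin W → Finset 𝒳) (p : ℕ) (size len : ℕ → ℕ)
    (pull : ℕ → Finset 𝒳 → ℕ → 𝒳) (coef : ℕ → Finset 𝒳 → 𝒳 → ℕ → ℝ) :
    BanditAlgorithm (𝒳 : Set (EuclideanSpace ℝ (Fin d))) where
  Seed := Fin W
  seedLaw := (PMF.uniformOfFintype (Fin W)).toMeasure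
  sample t u h :=
    (pull (roundAt len t) (survivors size (init u) (linEst len coef (extendZero h)) (roundAt len t))
      (t - startTime len (roundAt len t))).1
  sample_mem _ _ _ := Subtype.coe_prop _
  measurable_sample t := measurable_from_prod_countable_right fun u =>
    measurable_comp_of_measurableSet_fiber (measurableSet_survivors_eq size (init u)
      (fun l S x => (measurable_linEst len coef l S x).comp (measurable_extendZero t))
      (roundAt len t))
      fun S => (pull (roundAt len t) S (t - startTime len (roundAt len t))).1
  Stops t _ _ := t = startTime len p
  measurableSet_stops _ := .const _
  recommend _ u h := (pickArm x₀ (survivors size (init u) (linEst len coef (extendZero h)) p)).1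
  recommend_mem _ _ _ := Subtype.coe_prop _
  measurable_recommend t := measurable_from_prod_countable_right fun u =>
    measurable_comp_of_measurableSet_fiber (measurableSet_survivors_eq size (init u)
      (fun l S x => (measurable_linEst len coef l S x).comp (measurable_extendZero t)) p)
      fun S => (pickArm x₀ S).1

namespace BanditAlgorithm

/-- The reward of round `t`, as a function of the seed and of the noise. -/
noncomputable def reward {d : ℕ} {𝒳 : Set (EuclideanSpace ℝ (Fin d))} (A : BanditAlgorithm 𝒳)
    (θ : EuclideanSpace ℝ (Fin d)) (u : A.Seed) (η : ℕ → ℝ) (t : ℕ) : ℝ :=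
  inner ℝ (A.sample t u (A.history θ u η t)) θ + η t

lemma history_apply {d : ℕ} {𝒳 : Set (EuclideanSpace ℝ (Fin d))} (A : BanditAlgorithm 𝒳)
    (θ : EuclideanSpace ℝ (Fin d)) (u : A.Seed) (η : ℕ → ℝ) (t : ℕ) (i : Fin t) :
    A.history θ u η t i = A.reward θ u η i := by
  induction t with
  | zero => exact i.elim0
  | succ t ih =>
    rw [history]
    refine Fin.lastCases ?_ (fun j => ?_) i
    · simp [reward]
    · simp [ih]

end BanditAlgorithm

section

variable {d : ℕ} {𝒳 : Finset (EuclideanSpace ℝ (Fin d))} (x₀ : 𝒳) {W : ℕ} [NeZero W]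
  (init : Fin W → Finset 𝒳) (p : ℕ) (size len : ℕ → ℕ) (pull : ℕ → Finset 𝒳 → ℕ → 𝒳)
  (coef : ℕ → Finset 𝒳 → 𝒳 → ℕ → ℝ) (θ : EuclideanSpace ℝ (Fin d)) (u : Fin W) (η : ℕ → ℝ)

lemma eliminationAlgorithm_survivors_history {l t : ℕ} (hlt : startTime len l ≤ t) :
    survivors size (init u) (linEst len coef (extendZero
      ((eliminationAlgorithm x₀ init p size len pull coef).history θ u η t))) l =
    survivors size (init u) (linEst len coef
      ((eliminationAlgorithm x₀ init p size len pull coef).reward θ u η)) l := by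
  refine survivors_congr fun j hj x _ => linEst_congr _ (fun i _ hi => ?_) _ _
  have := startTime_mono len (show j + 1 ≤ l from hj)
  rw [extendZero, dif_pos (by omega), BanditAlgorithm.history_apply]

lemma eliminationAlgorithm_reward (hlen : ∀ l, 0 < len l) {l i : ℕ} (hi : i < len l) :
    (eliminationAlgorithm x₀ init p size len pull coef).reward θ u η (startTime len l + i) =
      inner ℝ (pull l (survivors size (init u) (linEst len coef
        ((eliminationAlgorithm x₀ init p size len pull coef).reward θ u η)) l) i).1 θ
        + η (startTime len l + i) := by
  rw [← eliminationAlgorithm_survivors_history x₀ init p size len pull coef θ u η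
    (Nat.le_add_right (startTime len l) i)]
  have hr := roundAt_startTime_add hlen hi
  change inner ℝ (pull (roundAt len (startTime len l + i)) _ _).1 θ + _ = _
  rw [hr, Nat.add_sub_cancel_left]

/-- Since the estimates are unbiased, running the elimination on the rewards amounts to running it
on the true values plus the same linear combinations of the noise. -/
lemma eliminationAlgorithm_survivors_reward (hlen : ∀ l, 0 < len l)
    (h0 : (init u).card = size 0) (hsize : ∀ l < p, size (l + 1) ≤ size l)
    (hcoef : ∀ l < p, ∀ S : Finset 𝒳, S.card = size l → ∀ x ∈ S,
      ∑ i ∈ Finset.range (len l), coef l S x i • (pull l S i).1 = x.1) {l : ℕ} (hl : l ≤ p) :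
    survivors size (init u) (linEst len coef
      ((eliminationAlgorithm x₀ init p size len pull coef).reward θ u η)) l =
    survivors size (init u) (fun l S x => inner ℝ x.1 θ + linEst len coef η l S x) l := by
  refine survivors_congr fun j hj x hx => ?_
  have hc := card_survivors (linEst len coef
      ((eliminationAlgorithm x₀ init p size len pull coef).reward θ u η)) h0 hsize
      (l := j) (by omega)
  have hxe := hcoef j (by omega) _ hc x hx
  conv_rhs => rw [← hxe]
  rw [sum_inner]
  simp only [linEst]
  rw [← Finset.sum_add_distrib]
  refine Finset.sum_congr rfl fun i hi => ?_
  rw [eliminationAlgorithm_reward x₀ init p size len pull coef θ u η hlen (Finset.mem_range.1 hi),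
    real_inner_smul_left, mul_add]

lemma eliminationAlgorithm_stoppingTime :
    (eliminationAlgorithm x₀ init p size len pull coef).stoppingTime θ u η = startTime len p := by
  unfold BanditAlgorithm.stoppingTime
  refine le_antisymm (iInf₂_le_of_le (startTime len p) rfl le_rfl) (le_iInf₂ fun t ht => ?_)
  have : t = startTime len p := ht
  rw [this]

lemma eliminationAlgorithm_output :
    (eliminationAlgorithm x₀ init p size len pull coef).output θ u η =
      (pickArm x₀ (survivors size (init u) (linEst len coef
      ((eliminationAlgorithm x₀ init p size len pull coef).reward θ u η)) p)).1 := by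
  rw [BanditAlgorithm.output, eliminationAlgorithm_stoppingTime,
    ← eliminationAlgorithm_survivors_history x₀ init p size len pull coef θ u η le_rfl]
  rfl

end

/-- A lower bound on the probability of `E` when, for each seed in `U`, it contains an event of
probability at least `c`. -/
lemma le_uniform_prod_of_forall_mem {W : ℕ} [NeZero W] {Ω : Type*} [MeasurableSpace Ω]
    (P : Measure Ω) [IsProbabilityMeasure P] (U : Finset (Fin W)) (G : Fin W → Set Ω)
    (hG : ∀ u, MeasurableSet (G u)) {c : ℝ} (hc : ∀ u ∈ U, c ≤ P.real (G u))
    {E : Set (Fin W × Ω)} (hE : ∀ u ∈ U, ∀ η ∈ G u, (u, η) ∈ E) :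
    ENNReal.ofReal (U.card / W * c) ≤ ((PMF.uniformOfFintype (Fin W)).toMeasure.prod P) E := by
  set Q := (PMF.uniformOfFintype (Fin W)).toMeasure.prod P with hQ
  have hsub : (⋃ u ∈ U, {u} ×ˢ G u) ⊆ E := by
    rintro ⟨u, η⟩ h
    simp only [Set.mem_iUnion, Set.mem_prod, Set.mem_singleton_iff] at h
    obtain ⟨v, hv, rfl, hη⟩ := h
    exact hE _ hv _ hη
  refine ENNReal.ofReal_le_of_le_toReal ?_
  refine le_trans ?_ (measureReal_mono (μ := Q) hsub)
  rw [measureReal_biUnion_finset (fun u _ v _ huv => Set.disjoint_left.2 fun ω h1 h2 =>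
    huv (h1.1.symm.trans h2.1)) (fun u _ => (measurableSet_singleton u).prod (hG u))]
  have hW : (0 : ℝ) < W := by exact_mod_cast NeZero.pos W
  calc (U.card : ℝ) / W * c = ∑ u ∈ U, 1 / (W : ℝ) * c := by simp; ring
    _ ≤ ∑ u ∈ U, Q.real ({u} ×ˢ G u) := by
      refine Finset.sum_le_sum fun u hu => ?_
      rw [hQ, measureReal_prod_prod]
      have : (PMF.uniformOfFintype (Fin W)).toMeasure.real {u} = 1 / W := by
        rw [measureReal_def, PMF.toMeasure_apply_singleton _ _ (measurableSet_singleton u)]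
        simp
      rw [this]
      exact mul_le_mul_of_nonneg_left (hc u hu) (by positivity)

/-- Correctness of phased elimination. If every arm lies in `init u` for at least `m` of the `W`
seeds, the best arm is among the initial ones with probability at least `m / W`, and given this the
`p` rounds lose at most `∑ l, ε l` except with probability `∑ l, q l`. -/
theorem eliminationAlgorithm_isPAC {d : ℕ} {𝒳 : Finset (EuclideanSpace ℝ (Fin d))} (x₀ : 𝒳)
    {W m : ℕ} [NeZero W] {init : Fin W → Finset 𝒳} {p : ℕ} {size len : ℕ → ℕ}
    {pull : ℕ → Finset 𝒳 → ℕ → 𝒳} {coef : ℕ → Finset 𝒳 → 𝒳 → ℕ → ℝ} {r : ℕ → ℝ} {ε q : ℕ → ℝ}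
    (hlen : ∀ l, 0 < len l)
    (h0 : ∀ u, (init u).card = size 0) (hsize : ∀ l < p, size (l + 1) ≤ size l) (h1 : size p = 1)
    (hcoef : ∀ l < p, ∀ S : Finset 𝒳, S.card = size l → ∀ x ∈ S,
      ∑ i ∈ Finset.range (len l), coef l S x i • (pull l S i).1 = x.1)
    (hvar : ∀ l < p, ∀ S : Finset 𝒳, S.card = size l → ∀ x ∈ S,
      ∑ i ∈ Finset.range (len l), coef l S x i ^ 2 ≤ 2 * r l / len l)
    (hr : ∀ l < p, 0 < r l) (hε : ∀ l < p, 0 ≤ ε l)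
    (hq : ∀ l < p, Real.exp (-(ε l ^ 2 * len l / (16 * r l))) * (1 + size l / size (l + 1)) ≤ q l)
    (hcover : ∀ x : 𝒳, m ≤ (Finset.univ.filter fun u => x ∈ init u).card)
    {ε' δ : ℝ} (hεsum : ∑ l ∈ Finset.range p, ε l ≤ ε')
    (hq1 : ∑ l ∈ Finset.range p, q l ≤ 1)
    (hδ : 1 - δ ≤ m / W * (1 - ∑ l ∈ Finset.range p, q l)) :
    (eliminationAlgorithm x₀ init p size len pull coef).IsPAC ε' δ := by
  intro θ
  have hanti : ∀ l ≤ p, 1 ≤ size l := by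
    intro l hl
    rw [← h1]
    exact Nat.decreasingInduction' (P := fun j => size p ≤ size j)
      (fun j hj _ h => h.trans (hsize j hj)) hl le_rfl
  -- `b` is a best arm, `G u` the event that the elimination started with `init u` succeeds.
  obtain ⟨b, -, hb⟩ := Finset.exists_max_image (Finset.univ : Finset 𝒳)
    (fun x => inner ℝ x.1 θ) ⟨x₀, Finset.mem_univ _⟩
  set st : Fin W → (ℕ → ℝ) → Finset 𝒳 := fun u η =>
    survivors size (init u) (fun l S x => inner ℝ x.1 θ + linEst len coef η l S x) p with hst
  let G : Fin W → Set (ℕ → ℝ) := fun u => {η | ∃ y ∈ st u η,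
    ∀ x ∈ init u, inner ℝ x.1 θ ≤ inner ℝ y.1 θ + ∑ l ∈ Finset.range p, ε l}
  have hGm : ∀ u, MeasurableSet (G u) := by
    intro u
    have : G u = ⋃ T : Finset 𝒳, {η | st u η = T} ∩ {_η | ∃ y ∈ T,
        ∀ x ∈ init u, inner ℝ x.1 θ ≤ inner ℝ y.1 θ + ∑ l ∈ Finset.range p, ε l} := by
      ext η
      simp [G]
    rw [this]
    exact .iUnion fun T => (measurableSet_survivors_eq size (init u)
      (fun l S x => (measurable_linEst len coef l S x).const_add _) p T).inter (.const _)
  have hGP : ∀ u, 1 - ∑ l ∈ Finset.range p, q l ≤ gaussianNoise.real (G u) := by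
    intro u
    have h := gaussianNoise_survivors_loses_le size len p (init u) (h0 u) hsize hanti coef
      (fun x => inner ℝ x.1 θ) ε q (fun l => 2 * r l / len l) hε
      (fun l hl => div_pos (by linarith [hr l hl]) (by exact_mod_cast hlen l)) hvar
      (fun l hl => by
        refine le_trans (le_of_eq ?_) (hq l hl)
        have h1 := (hr l hl).ne'
        have h2 : (len l : ℝ) ≠ 0 := by exact_mod_cast (hlen l).ne'
        congr 2
        field_simp
        ring)
    have h2 := probReal_compl_eq_one_sub (μ := gaussianNoise) (hGm u)
    have h3 : gaussianNoise.real (G u)ᶜ ≤ ∑ l ∈ Finset.range p, q l := h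
    linarith
  refine le_trans (ENNReal.ofReal_le_ofReal ?_) (le_uniform_prod_of_forall_mem gaussianNoise
    (Finset.univ.filter fun u => b ∈ init u) G hGm (fun u _ => hGP u) ?_)
  · refine hδ.trans (mul_le_mul_of_nonneg_right ?_ (by linarith))
    gcongr
    exact hcover b
  · intro u hu η hη
    have hbu : b ∈ init u := (Finset.mem_filter.1 hu).2
    obtain ⟨y, hy, hyb⟩ := hη
    refine ⟨by rw [eliminationAlgorithm_stoppingTime]; exact ENat.natCast_lt_top _, fun x hx => ?_⟩
    have hout : (eliminationAlgorithm x₀ init p size len pull coef).output θ u η = y.1 := by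
      rw [eliminationAlgorithm_output,
        eliminationAlgorithm_survivors_reward x₀ init p size len pull coef θ u η hlen
          (h0 u) hsize hcoef le_rfl]
      have hc : (st u η).card = 1 := (card_survivors _ (h0 u) hsize le_rfl).trans h1
      have hpm : pickArm x₀ (st u η) ∈ st u η := pickArm_mem x₀ ⟨y, hy⟩
      exact congrArg Subtype.val (Finset.card_le_one.1 hc.le _ hpm _ hy)
    simp only [hout, inner_sub_left]
    have h2 := hyb b hbu
    have h3 := hb ⟨x, hx⟩ (Finset.mem_univ _)
    simp only at h3
    linarith

/-! ### The schedule -/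

/-- The exact design for a set `S` of arms, when either the number of arms or the ambient dimension
is at most `r`, with points and coefficients indexed by `ℕ`. -/
lemma exists_design_on_arms {E : Type*} [AddCommGroup E] [Module ℝ E] {𝒳 : Finset E}
    (S : Finset 𝒳) (hS : S.Nonempty) {r n : ℕ} (hcard : S.card ≤ r ∨ Module.finrank ℝ E ≤ r)
    [FiniteDimensional ℝ E] (hn : 2 * r ≤ n) (hn0 : 0 < n) :
    ∃ (s : ℕ → 𝒳) (a : 𝒳 → ℕ → ℝ), ∀ x ∈ S,
      (∑ i ∈ Finset.range n, a x i • (s i : E)) = x ∧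
      ∑ i ∈ Finset.range n, a x i ^ 2 ≤ 2 * r / n := by
  classical
  set T : Finset E := S.map (Function.Embedding.subtype _) with hT
  have hTX : ∀ y ∈ T, y ∈ 𝒳 := by
    intro y hy
    obtain ⟨x, -, rfl⟩ := Finset.mem_map.1 hy
    exact x.2
  have hr : Module.finrank ℝ (Submodule.span ℝ (T : Set E)) ≤ r := by
    rcases hcard with h | h
    · exact (finrank_span_finset_le_card T).trans (by simpa [hT] using h)
    · exact (Submodule.finrank_le _).trans h
  obtain ⟨s, hs⟩ := exists_exact_design T (by simpa [hT] using hS) hr hn hn0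
  choose a ha hb using hs
  refine ⟨fun i => if h : i < n then ⟨s ⟨i, h⟩, hTX _ (s ⟨i, h⟩).2⟩ else hS.choose,
    fun x i => if h : x.1 ∈ T ∧ i < n then a x.1 h.1 ⟨i, h.2⟩ else 0, fun x hx => ?_⟩
  have hxT : x.1 ∈ T := Finset.mem_map_of_mem _ hx
  rw [Finset.sum_range, Finset.sum_range]
  constructor
  · refine Eq.trans (Finset.sum_congr rfl fun i _ => ?_) (ha x.1 hxT)
    simp [hxT]
  · refine le_trans (le_of_eq (Finset.sum_congr rfl fun i _ => ?_)) (hb x.1 hxT)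
    simp [hxT]

/-- The windows of `m` cyclically consecutive elements in an enumeration of `α`: each has `m`
elements, and each element lies in `m` of them. -/
lemma exists_cyclic_windows {α : Type*} [Fintype α] [DecidableEq α] {K m : ℕ} [NeZero K]
    (hK : Fintype.card α = K) (hm : m ≤ K) :
    ∃ init : Fin K → Finset α, (∀ u, (init u).card = m) ∧
      ∀ x, (Finset.univ.filter fun u => x ∈ init u).card = m := by
  let e : α ≃ Fin K := Fintype.equivFinOfCardEq hK
  have hcard : (Finset.univ.filter fun j : Fin K => j.1 < m).card = m := by
    rw [Fin.card_filter_val_lt]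
    omega
  refine ⟨fun u => Finset.univ.filter fun x => (e x - u).1 < m, fun u => ?_, fun x => ?_⟩
  · refine Eq.trans (Finset.card_equiv (e.trans (Equiv.subRight u)) ?_) hcard
    simp
  · refine Eq.trans (Finset.card_equiv (Equiv.subLeft (e x)) ?_) hcard
    simp

lemma sum_succ_mul_geometric_le (p : ℕ) :
    ∑ l ∈ Finset.range p, ((l : ℝ) + 1) * (8 / 9) ^ l ≤ 81 := by
  have h : ∑ l ∈ Finset.range p, ((l : ℝ) + 1) * (8 / 9) ^ l = 81 - (9 * p + 81) * (8 / 9) ^ p := by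
    induction p with
    | zero => simp
    | succ p ih => rw [Finset.sum_range_succ, ih]; push_cast; ring
  rw [h]
  have : (0 : ℝ) ≤ (9 * p + 81) * (8 / 9) ^ p := by positivity
  linarith

/-- The number of arms with which round `l` starts: `m` arms at first, cut down to `D` in one
round, and then halved in each round. -/
def roundSize (m D : ℕ) : ℕ → ℕ
  | 0 => m
  | l + 1 => D / 2 ^ l

/-- The bound on the dimension spanned by the arms of round `l`. By truncated subtraction it is `D`
in the rounds `0` and `1`. -/
def roundDim (D l : ℕ) : ℕ := D / 2 ^ (l - 1)

lemma roundSize_succ_le {m D : ℕ} (hDm : D ≤ m) (l : ℕ) :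
    roundSize m D (l + 1) ≤ roundSize m D l := by
  cases l with
  | zero => simpa [roundSize] using hDm
  | succ l =>
    simp only [roundSize]
    exact Nat.div_le_div_left (Nat.pow_le_pow_right (by norm_num) (Nat.le_succ l)) (by positivity)

lemma roundSize_last (m : ℕ) {D : ℕ} (hD : D ≠ 0) : roundSize m D (Nat.log 2 D + 1) = 1 := by
  simp only [roundSize]
  have h1 := Nat.pow_log_le_self 2 hD
  have h2 := Nat.lt_pow_succ_log_self (b := 2) (by norm_num) D
  rw [pow_succ] at h2
  refine Nat.div_eq_of_lt_le (by omega) (by omega)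

lemma one_le_roundSize {m D l : ℕ} (hDm : D ≤ m) (hD : D ≠ 0) (hl : l ≤ Nat.log 2 D + 1) :
    1 ≤ roundSize m D l := by
  rw [← roundSize_last m hD]
  exact antitone_nat_of_succ_le (roundSize_succ_le hDm) hl

lemma roundSize_le_three_mul {m D l : ℕ} (h : 1 ≤ roundSize m D (l + 2)) :
    roundSize m D (l + 1) ≤ 3 * roundSize m D (l + 2) := by
  simp only [roundSize] at h ⊢
  rw [pow_succ, ← Nat.div_div_eq_div_mul] at h ⊢
  omega

lemma one_le_roundDim {D l : ℕ} (hD : D ≠ 0) (hl : l < Nat.log 2 D + 1) : 1 ≤ roundDim D l := by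
  rw [roundDim, Nat.one_le_div_iff (by positivity)]
  exact (Nat.pow_le_pow_right (by norm_num) (by omega)).trans (Nat.pow_log_le_self 2 hD)

lemma roundDim_le (D l : ℕ) : (roundDim D l : ℝ) ≤ 2 * D / 2 ^ l := by
  refine Nat.cast_div_le.trans ?_
  push_cast
  cases l with
  | zero => simp; linarith [(Nat.cast_nonneg D : (0:ℝ) ≤ D)]
  | succ l =>
    simp only [Nat.add_sub_cancel]
    rw [pow_succ]
    apply le_of_eq
    field_simp

lemma one_add_roundSize_ratio_le {m D l : ℕ} (hDm : D ≤ m) (hD : D ≠ 0)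
    (hl : l < Nat.log 2 D + 1) :
    1 + (roundSize m D l : ℝ) / roundSize m D (l + 1) ≤ 4 * (m / D) := by
  have hD0 : (0 : ℝ) < D := by exact_mod_cast Nat.pos_of_ne_zero hD
  have h1 : (1 : ℝ) ≤ m / D := by
    rw [one_le_div hD0]; exact_mod_cast hDm
  cases l with
  | zero => simp only [roundSize, pow_zero, Nat.div_one]; linarith
  | succ l =>
    have h := one_le_roundSize hDm hD (show l + 2 ≤ Nat.log 2 D + 1 by omega)
    have h3 : (roundSize m D (l + 1) : ℝ) ≤ 3 * roundSize m D (l + 2) := by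
      exact_mod_cast roundSize_le_three_mul h
    have h0 : (0 : ℝ) < roundSize m D (l + 2) := by exact_mod_cast h
    have : (roundSize m D (l + 1) : ℝ) / roundSize m D (l + 2) ≤ 3 := by
      rw [div_le_iff₀ h0]; exact h3
    show 1 + (roundSize m D (l + 1) : ℝ) / roundSize m D (l + 2) ≤ _
    linarith

/-- Returning a uniformly random arm, without sampling. -/
lemma exists_isPAC_usesAtMost_zero {d : ℕ} {𝒳 : Finset (EuclideanSpace ℝ (Fin d))}
    (h𝒳 : 𝒳.Nonempty) {ε δ : ℝ} (hε : 0 < ε) (hδ : 1 - δ ≤ 1 / 𝒳.card) :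
    ∃ A : BanditAlgorithm (𝒳 : Set (EuclideanSpace ℝ (Fin d))), A.IsPAC ε δ ∧ A.UsesAtMost 0 := by
  classical
  obtain ⟨x₀, hx₀⟩ := h𝒳
  have hK : 𝒳.card ≠ 0 := (Finset.card_pos.2 ⟨x₀, hx₀⟩).ne'
  have : NeZero 𝒳.card := ⟨hK⟩
  obtain ⟨init, hi1, hi2⟩ := exists_cyclic_windows (α := 𝒳) (K := 𝒳.card) (m := 1) (by simp)
    (by omega)
  refine ⟨eliminationAlgorithm ⟨x₀, hx₀⟩ init 0 (fun _ => 1) (fun _ => 1)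
    (fun _ _ _ => ⟨x₀, hx₀⟩) (fun _ _ _ _ => 0), ?_, ?_⟩
  · refine eliminationAlgorithm_isPAC (m := 1) (r := fun _ => 1) (ε := fun _ => 0) (q := fun _ => 0)
      _ (by simp) hi1 (by simp) rfl (by simp) (by simp) (by simp) (by simp) (by simp)
      (fun x => (hi2 x).ge) (by simpa using hε.le) (by simp) (by simpa using hδ)
  · intro θ u η
    rw [eliminationAlgorithm_stoppingTime]
    simp [startTime]

/-- Phased elimination on a random window of `m` arms. With `D = min m d` and
`L = log (8 (m / D) / δ₀)`, round `l` has accuracy `(ε / 4) (3 / 4) ^ l`, failure probability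
`δ₀ / 2 ^ (l + 1)` and about `L (l + 1) (16 / 9) ^ l D / (2 ^ l ε ^ 2)` samples, up to a
constant; all three are summable. -/
theorem exists_isPAC_of_window {d : ℕ} (hd : 1 ≤ d) {𝒳 : Finset (EuclideanSpace ℝ (Fin d))}
    {m : ℕ} (hm : 1 ≤ m) (hmK : m ≤ 𝒳.card) {ε δ δ₀ : ℝ} (hε : 0 < ε) (hε1 : ε ≤ 1)
    (hδ₀ : 0 < δ₀) (hδ₀1 : δ₀ ≤ 1) (hδ : 1 - δ ≤ m / 𝒳.card * (1 - δ₀)) :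
    ∃ (A : BanditAlgorithm (𝒳 : Set (EuclideanSpace ℝ (Fin d)))) (N : ℕ),
      A.IsPAC ε δ ∧ A.UsesAtMost N ∧
        (N : ℝ) ≤ 124416 * ((min m d : ℕ) *
          Real.log (8 * ((m : ℝ) / (min m d : ℕ)) / δ₀) / ε ^ 2) := by
  classical
  set D := min m d with hDdef
  have hD : D ≠ 0 := by omega
  have hDm : D ≤ m := min_le_left _ _
  have hD0 : (0 : ℝ) < D := by exact_mod_cast Nat.pos_of_ne_zero hD
  have hratio : (1 : ℝ) ≤ m / D := by
    rw [one_le_div hD0]; exact_mod_cast hDm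
  set L := Real.log (8 * ((m : ℝ) / D) / δ₀) with hL
  have h8 : 8 ≤ 8 * ((m : ℝ) / D) / δ₀ := by
    rw [le_div_iff₀ hδ₀]; nlinarith
  have hexpL : Real.exp (-L) = δ₀ / (8 * (m / D)) := by
    rw [hL, Real.exp_neg, Real.exp_log (by linarith), inv_div]
  have hL1 : 1 ≤ L := by
    rw [hL, Real.le_log_iff_exp_le (by linarith)]
    linarith [Real.exp_one_lt_d9]
  obtain ⟨x₀, hx₀⟩ : 𝒳.Nonempty := Finset.card_pos.1 (by omega)
  have : NeZero 𝒳.card := ⟨by omega⟩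
  obtain ⟨init, hi1, hi2⟩ := exists_cyclic_windows (α := 𝒳) (K := 𝒳.card) (by simp) hmK
  set p := Nat.log 2 D + 1 with hp
  -- `ep l`, `need l` and `len l`: accuracy, required and actual number of samples of round `l`.
  set ep : ℕ → ℝ := fun l => ε / 4 * (3 / 4) ^ l with hep
  have hep0 : ∀ l, 0 < ep l := fun l => by simp only [hep]; positivity
  set need : ℕ → ℝ := fun l => 16 * roundDim D l * (L * (l + 1)) / ep l ^ 2 with hneed
  set len : ℕ → ℕ := fun l => ⌈need l⌉₊ + 1 with hlendef
  have hlen0 : ∀ l, 0 < len l := fun l => Nat.succ_pos _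
  have hneed_le : ∀ l, need l ≤ len l := fun l => by
    simp only [hlendef]; push_cast; linarith [Nat.le_ceil (need l)]
  have hep1 : ∀ l, ep l ≤ 1 := fun l => by
    have : (3 / 4 : ℝ) ^ l ≤ 1 := pow_le_one₀ (by norm_num) (by norm_num)
    have h0 : (0 : ℝ) ≤ (3 / 4) ^ l := by positivity
    simp only [hep]; nlinarith
  have hneed_ge : ∀ l, 16 * (roundDim D l : ℝ) ≤ need l := fun l => by
    have h1 : ep l ^ 2 ≤ 1 := pow_le_one₀ (hep0 l).le (hep1 l)
    have h2 : 1 ≤ L * (l + 1) := by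
      have : (0 : ℝ) ≤ l := Nat.cast_nonneg l
      nlinarith
    have h3 : (0 : ℝ) ≤ roundDim D l := Nat.cast_nonneg _
    simp only [hneed]
    rw [le_div_iff₀ (by have := hep0 l; positivity)]
    calc 16 * (roundDim D l : ℝ) * ep l ^ 2 ≤ 16 * (roundDim D l : ℝ) * 1 := by gcongr
      _ ≤ _ := by gcongr
  have hdesign : ∀ l (S : Finset 𝒳), ∃ (s : ℕ → 𝒳) (a : 𝒳 → ℕ → ℝ), l < p →
      S.card = roundSize m D l → ∀ x ∈ S,
      (∑ i ∈ Finset.range (len l), a x i • (s i).1) = x.1 ∧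
      ∑ i ∈ Finset.range (len l), a x i ^ 2 ≤ 2 * roundDim D l / len l := by
    intro l S
    by_cases h : l < p ∧ S.card = roundSize m D l
    · have hS : S.Nonempty := Finset.card_pos.1 (by
        rw [h.2]; exact one_le_roundSize hDm hD h.1.le)
      have hdim : S.card ≤ roundDim D l ∨
          Module.finrank ℝ (EuclideanSpace ℝ (Fin d)) ≤ roundDim D l := by
        rw [h.2, finrank_euclideanSpace_fin]
        cases l with
        | zero => simp only [roundSize, roundDim, Nat.zero_sub, pow_zero, Nat.div_one]; omega
        | succ l => left; simp [roundSize, roundDim]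
      have h2 : 2 * roundDim D l ≤ len l := by
        have h3 : ((2 * roundDim D l : ℕ) : ℝ) ≤ len l := by
          push_cast
          have : (0 : ℝ) ≤ roundDim D l := Nat.cast_nonneg _
          linarith [hneed_ge l, hneed_le l]
        exact_mod_cast h3
      obtain ⟨s, a, hsa⟩ := exists_design_on_arms S hS hdim h2 (hlen0 l)
      exact ⟨s, a, fun _ _ => hsa⟩
    · exact ⟨fun _ => ⟨x₀, hx₀⟩, fun _ _ => 0, fun h1 h2 => absurd ⟨h1, h2⟩ h⟩
  choose pull coef hpc using hdesign
  have hqsum : ∑ l ∈ Finset.range p, δ₀ / 2 * (1 / 2) ^ l ≤ δ₀ := by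
    rw [← Finset.mul_sum, geom_sum_eq (by norm_num)]
    have : (0 : ℝ) ≤ δ₀ * (1 / 2) ^ p := by positivity
    calc δ₀ / 2 * (((1 / 2) ^ p - 1) / (1 / 2 - 1)) = δ₀ - δ₀ * (1 / 2) ^ p := by ring
      _ ≤ δ₀ := by linarith
  refine ⟨eliminationAlgorithm ⟨x₀, hx₀⟩ init p (roundSize m D) len pull coef,
    startTime len p, ?_, ?_, ?_⟩
  · refine eliminationAlgorithm_isPAC (m := m) (r := fun l => roundDim D l) (ε := ep)
      (q := fun l => δ₀ / 2 * (1 / 2) ^ l) _ hlen0 hi1 (fun l _ => roundSize_succ_le hDm l)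
      (roundSize_last m hD) (fun l hl S hS x hx => (hpc l S hl hS x hx).1)
      (fun l hl S hS x hx => (hpc l S hl hS x hx).2)
      (fun l hl => by exact_mod_cast one_le_roundDim hD hl) (fun l _ => (hep0 l).le) ?_
      (fun x => (hi2 x).ge) ?_ (hqsum.trans hδ₀1) ?_
    · intro l hl
      have hdim : (0 : ℝ) < roundDim D l := by exact_mod_cast one_le_roundDim hD hl
      have h1 : L * (l + 1) ≤ ep l ^ 2 * len l / (16 * roundDim D l) := by
        rw [le_div_iff₀ (by positivity)]
        have h2 := hneed_le l
        simp only [hneed] at h2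
        rw [div_le_iff₀ (by have := hep0 l; positivity)] at h2
        linarith
      have h3 : Real.exp (-(ep l ^ 2 * len l / (16 * roundDim D l))) ≤
          (δ₀ / (8 * (m / D))) ^ (l + 1) := by
        rw [← hexpL, ← Real.exp_nat_mul]
        refine Real.exp_le_exp.2 ?_
        push_cast
        linarith
      have h4 : δ₀ / (8 * (m / D)) ≤ 1 / 2 := by
        rw [div_le_div_iff₀ (by positivity) (by norm_num)]
        nlinarith
      have h5 : (0 : ℝ) ≤ δ₀ / (8 * (m / D)) := by positivity
      calc _ ≤ (δ₀ / (8 * (m / D))) ^ (l + 1) * (4 * (m / D)) := by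
            refine mul_le_mul h3 (one_add_roundSize_ratio_le hDm hD hl) (by positivity)
              (by positivity)
        _ = δ₀ / 2 * (δ₀ / (8 * (m / D))) ^ l := by
            have : (m / D : ℝ) ≠ 0 := by linarith
            generalize (m / D : ℝ) = z at *
            rw [pow_succ]
            field_simp
            norm_num
        _ ≤ δ₀ / 2 * (1 / 2) ^ l := by gcongr
    · simp only [hep]
      rw [← Finset.mul_sum, geom_sum_eq (by norm_num)]
      have : (0 : ℝ) ≤ ε * (3 / 4) ^ p := by positivity
      calc ε / 4 * (((3 / 4) ^ p - 1) / (3 / 4 - 1)) = ε - ε * (3 / 4) ^ p := by ring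
        _ ≤ ε := by linarith
    · refine hδ.trans (mul_le_mul_of_nonneg_left (by linarith) (by positivity))
  · intro θ u η
    rw [eliminationAlgorithm_stoppingTime]
  · have hstep : ∀ l ∈ Finset.range p, (len l : ℝ) ≤
        1536 * (D * L / ε ^ 2) * ((l + 1) * (8 / 9) ^ l) := by
      intro l hl
      have hdim : (1 : ℝ) ≤ roundDim D l := by
        exact_mod_cast one_le_roundDim hD (Finset.mem_range.1 hl)
      have h1 : (len l : ℝ) ≤ need l + 2 := by
        simp only [hlendef]; push_cast
        linarith [Nat.ceil_lt_add_one (show 0 ≤ need l by linarith [hneed_ge l])]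
      have h2 : need l ≤ 512 * (D * L / ε ^ 2) * ((l + 1) * (8 / 9) ^ l) := by
        have h3 : need l ≤ 16 * (2 * D / 2 ^ l) * (L * (l + 1)) / ep l ^ 2 := by
          simp only [hneed]
          gcongr
          exact roundDim_le D l
        refine h3.trans (le_of_eq ?_)
        have h4 : (8 / 9 : ℝ) ^ l = (1 / 2 ^ l) / ((3 / 4) ^ l) ^ 2 := by
          rw [← pow_mul, mul_comm l 2, pow_mul, ← one_div_pow, ← div_pow]
          norm_num
        rw [h4]
        simp only [hep]
        field_simp
        norm_num
      linarith [hneed_ge l]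
    rw [startTime]
    push_cast
    calc _ ≤ ∑ l ∈ Finset.range p, 1536 * (D * L / ε ^ 2) * (((l : ℝ) + 1) * (8 / 9) ^ l) :=
          Finset.sum_le_sum hstep
      _ = 1536 * (D * L / ε ^ 2) * ∑ l ∈ Finset.range p, ((l : ℝ) + 1) * (8 / 9) ^ l := by
          rw [Finset.mul_sum]
      _ ≤ 1536 * (D * L / ε ^ 2) * 81 := by
          gcongr
          exact sum_succ_mul_geometric_le p
      _ = _ := by ring

/-! ### The choice of the window -/

theorem mainTheorem7 :
    ∃ C : ℝ, 0 < C ∧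
      ∀ (d : ℕ), 1 ≤ d →
      ∀ (𝒳 : Finset (EuclideanSpace ℝ (Fin d))), 𝒳.Nonempty →
      ∀ (ε δ : ℝ), 0 < ε → ε ≤ 1 → 0 < δ → δ < 1 →
        ∃ (A : BanditAlgorithm (𝒳 : Set (EuclideanSpace ℝ (Fin d)))) (N : ℕ),
          A.IsPAC ε δ ∧ A.UsesAtMost N ∧
            (N : ℝ) ≤ C * (d * Real.log (max 1 ((𝒳.card : ℝ) / d) / δ) / ε ^ 2) := by
  refine ⟨32 * 124416, by norm_num, fun d hd 𝒳 h𝒳 ε δ hε hε1 hδ hδ1 => ?_⟩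
  set K := 𝒳.card with hKdef
  have hK : 1 ≤ K := Finset.card_pos.2 h𝒳
  have hK0 : (0 : ℝ) < K := by exact_mod_cast hK
  have hd0 : (0 : ℝ) < d := by exact_mod_cast hd
  set ρ : ℝ := max 1 ((K : ℝ) / d) with hρ
  have hρ1 : 1 ≤ ρ := le_max_left _ _
  have hρK : (K : ℝ) ≤ ρ * d := by
    rw [← div_le_iff₀ hd0]; exact le_max_right _ _
  have hΛ : Real.log δ⁻¹ ≤ Real.log (ρ / δ) := by
    refine Real.log_le_log (by positivity) ?_
    rw [inv_eq_one_div]; gcongr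
  have hγ : 1 - δ ≤ Real.log (ρ / δ) := by
    refine le_trans ?_ hΛ
    rw [Real.log_inv]
    linarith [Real.log_le_sub_one_of_pos hδ]
  have hΛ0 : 0 ≤ Real.log (ρ / δ) := by linarith
  rcases le_or_gt 2 (ρ / δ) with hcase | hcase
  -- Here `log (ρ / δ)` absorbs the constant `log 8`, and all arms are used.
  · obtain ⟨A, N, hA, hN, hNle⟩ := exists_isPAC_of_window hd hK le_rfl hε hε1 hδ hδ1.le
      (δ := δ) (by rw [div_self hK0.ne', one_mul])
    refine ⟨A, N, hA, hN, hNle.trans ?_⟩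
    have hD0 : (0 : ℝ) < (min K d : ℕ) := by
      exact_mod_cast lt_min (by omega : 0 < K) (by omega : 0 < d)
    have hDd : ((min K d : ℕ) : ℝ) ≤ d := by exact_mod_cast min_le_right K d
    have hq : (K : ℝ) / (min K d : ℕ) ≤ ρ := by
      rw [div_le_iff₀ hD0]
      rcases le_total K d with h | h
      · rw [min_eq_left h]; nlinarith
      · rw [min_eq_right h]; exact hρK
    have hlog : Real.log (8 * ((K : ℝ) / (min K d : ℕ)) / δ) ≤ 4 * Real.log (ρ / δ) := by
      have h1 : Real.log (8 * ((K : ℝ) / (min K d : ℕ)) / δ) ≤ Real.log ((ρ / δ) ^ 4) := by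
        refine Real.log_le_log (by positivity) ?_
        calc 8 * ((K : ℝ) / (min K d : ℕ)) / δ ≤ 8 * ρ / δ := by gcongr
          _ = 2 ^ 3 * (ρ / δ) := by ring
          _ ≤ (ρ / δ) ^ 3 * (ρ / δ) := by gcongr
          _ = (ρ / δ) ^ 4 := by ring
      rw [Real.log_pow] at h1
      exact_mod_cast h1
    calc _ ≤ 124416 * ((min K d : ℕ) * (4 * Real.log (ρ / δ)) / ε ^ 2) := by gcongr
      _ ≤ 124416 * (d * (4 * Real.log (ρ / δ)) / ε ^ 2) := by gcongr
      _ = 4 * 124416 * (d * Real.log (ρ / δ) / ε ^ 2) := by ring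
      _ ≤ _ := by gcongr; norm_num
  -- Here `δ > 1 / 2` and `K < 2 d`: success with the small probability `1 - δ` is enough, so a
  -- window of about `2 (1 - δ) K` arms is treated with confidence `1 / 2`.
  · rw [div_lt_iff₀ hδ] at hcase
    have hγ0 : 0 < 1 - δ := by linarith
    have hKd : K < 2 * d := by
      have : (K : ℝ) < 2 * d := by nlinarith
      exact_mod_cast this
    set m := ⌈2 * (1 - δ) * K⌉₊ with hmdef
    have hm1 : 1 ≤ m := Nat.one_le_ceil_iff.2 (by positivity)
    have hmK : m ≤ K := Nat.ceil_le.2 (by nlinarith)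
    have hmle : 2 * (1 - δ) * K ≤ m := Nat.le_ceil _
    rcases eq_or_lt_of_le hm1 with hm | hm
    · obtain ⟨A, hA, hN⟩ := exists_isPAC_usesAtMost_zero h𝒳 (δ := δ) hε (by
        rw [← hKdef, le_div_iff₀ hK0]
        rw [← hm] at hmle
        push_cast at hmle
        nlinarith)
      exact ⟨A, 0, hA, hN, by push_cast; positivity⟩
    · obtain ⟨A, N, hA, hN, hNle⟩ := exists_isPAC_of_window hd hm1 hmK hε hε1
        (δ₀ := 1 / 2) (δ := δ) (by norm_num) (by norm_num) (by
          rw [div_mul_eq_mul_div, le_div_iff₀ hK0]; linarith)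
      refine ⟨A, N, hA, hN, hNle.trans ?_⟩
      have hD0 : (0 : ℝ) < (min m d : ℕ) := by
        exact_mod_cast lt_min (by omega : 0 < m) (by omega : 0 < d)
      have hm2 : (2 : ℝ) ≤ m := by exact_mod_cast hm
      have hmlt : (m : ℝ) < 2 * (1 - δ) * K + 1 := Nat.ceil_lt_add_one (by positivity)
      have hKd' : (K : ℝ) ≤ 2 * d := by exact_mod_cast hKd.le
      have hDle : ((min m d : ℕ) : ℝ) ≤ 8 * (1 - δ) * d := by
        calc ((min m d : ℕ) : ℝ) ≤ m := by exact_mod_cast min_le_left m d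
          _ ≤ 4 * (1 - δ) * K := by linarith
          _ ≤ 4 * (1 - δ) * (2 * d) := by gcongr
          _ = _ := by ring
      have hq : (m : ℝ) / (min m d : ℕ) ≤ 2 := by
        rw [div_le_iff₀ hD0]
        have : m ≤ 2 * min m d := by omega
        exact_mod_cast this
      have hlog : Real.log (8 * ((m : ℝ) / (min m d : ℕ)) / (1 / 2)) ≤ 4 := by
        have h1 : Real.log (8 * ((m : ℝ) / (min m d : ℕ)) / (1 / 2)) ≤ Real.log (2 ^ 5) := by
          refine Real.log_le_log (by positivity) ?_
          linarith
        rw [Real.log_pow] at h1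
        refine h1.trans ?_
        norm_num
        linarith [Real.log_two_lt_d9]
      calc _ ≤ 124416 * ((min m d : ℕ) * 4 / ε ^ 2) := by gcongr
        _ ≤ 124416 * (8 * (1 - δ) * d * 4 / ε ^ 2) := by gcongr
        _ = 32 * 124416 * (d * (1 - δ) / ε ^ 2) := by ring
        _ ≤ _ := by gcongr
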